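/- **Setting.** There are $N\ge 1$ databases and $K\ge 1$ independent messages $W_1,\dots,W_K$, each uniform on $\{0,1\}^L$, $L\ge 1$. In a PIR scheme with uncoded storage, database $n$ stores a set $Z_n$ of message bits. A user who requests $W_k$ draws queries $Q^{[k]}_1,\dots,Q^{[k]}_N$ independently of the messages, and database $n$ returns a bit string $A^{[k]}_n$ that is a function of $Q^{[k]}_n$ and $Z_n$ and whose length is determined by $Q_n^{[k]}$. The scheme must be correct ($W_k$ is a function, with zero error, of all queries and answers) and private (for each $n$ the joint law of $(Q^{[k]}_n,A^{[k]}_n,W_1,\dots,W_K,Z_1,\dots,Z_N)$ does not depend on $k$). Its rate is $L/D$, where $D$ is the total number of downloaded bits; if this number is random, $D$ is either its expectation or its largest value, maximized over the requested message (the theorem holds under each of the two conventions, used throughout). It is an FS-PIR (full storage) scheme if every database stores all $KL$ bits, and an SC-PIR (storage constrained) scheme with parameter $\mu$ if every database stores at most $\mu KL$ bits. For given databases, $K$ (and $\mu$), the FS-PIR (SC-PIR) capacity is the maximum of the rates of all FS-PIR (SC-PIR) schemes, over all message lengths (and all uncoded placements); a scheme is capacity-achieving if its rate equals this maximum. **Theorem.**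 Let $N,K,F\ge 1$, $\frac1N\le\mu\le 1$ and $t=\mu N$. Let $\alpha_1,\dots,\alpha_F$ be rational numbers with $\sum_f\alpha_f=1$ such that every $\alpha_f L$ is a positive integer. Split each message $W_k$ into $F$ disjoint sub-messages $W_{k,1},\dots,W_{k,F}$ of $\alpha_1L,\dots,\alpha_FL$ bits. Let $\mathcal N_1,\dots,\mathcal N_F\subseteq\{1,\dots,N\}$ be non-empty, with $\sum_{f:\,n\in\mathcal N_f}\alpha_f\le\mu$ for every $n$, and let database $n$ store exactly the sub-messages $W_{k,f}$ with $n\in\mathcal N_f$, $k=1,\dots,K$. For each $f$ let a capacity-achieving FS-PIR scheme for $K$ messages of $\alpha_fL$ bits on the databases in $\mathcal N_f$ be given. Consider the scheme in which a user who requests $W_\theta$ retrieves, for each $f$, the sub-message $W_{\theta,f}$ from the databases in $\mathcal N_f$ with the $f$-th of these schemes, independently for different $f$. This is an SC-PIR scheme with parameter $\mu$, and it achieves the SC-PIR capacity for $N$ databases, $K$ messages and $\mu$, in each of the following two cases: 1. $t$ is an integer and $|\mathcal N_f|=t$ for all $f$; 2. $t$ is not an integer, $|\mathcal N_f|\in\{\lfloor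 t\rfloor,\lceil t\rceil\}$ for all $f$, $$\sum_{f:\,|\mathcal N_f|=\lfloor t\rfloor}\alpha_f=\lceil t\rceil-t\qquad\text{and}\qquad \sum_{f:\,|\mathcal N_f|=\lceil t\rceil}\alpha_f=t-\lfloor t\rfloor .$$ -/

import Mathlib

open scoped ENNReal

/-- `K` messages of `L` bits each. -/
abbrev Messages (K L : ℕ) : Type := Fin K → Fin L → Bool

/-- A PIR scheme with uncoded storage for `K` messages of `L` bits, the databases being the elements
of `𝒟`: what each database stores, the law of the queries and the answers of the databases. -/
structure PIRScheme (𝒟 : Type) (K L : ℕ) where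
  /-- The message bits stored at a database; `(k, i)` is bit `i` of message `k`. -/
  stored : 𝒟 → Finset (Fin K × Fin L)
  /-- The queries that can be sent to a database. -/
  Query : 𝒟 → Type
  /-- The joint law of the queries to all databases when message `k` is requested. The messages are
  not an argument: the queries are independent of them. -/
  queryLaw : Fin K → PMF (∀ n, Query n)
  /-- The positions of the bits of the answer to a query. Their number depends on the query alone. -/
  Slot : ∀ n, Query n → Type
  /-- An answer consists of finitely many bits. -/
  slotFintype : ∀ n q, Fintype (Slot n q)
  /-- The answer, a function of the query and of the stored bits. -/
  answer : ∀ n (q : Query n), (stored n → Bool) → Slot n q → Bool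

attribute [instance] PIRScheme.slotFintype

/-- Whether the number of downloaded bits of a scheme in which this number is random is its
expectation or its largest value. -/
inductive DownloadConvention where
  | average
  | worstCase

namespace PIRScheme

variable {𝒟 : Type} {K L : ℕ} (S : PIRScheme 𝒟 K L)

/-- The content `Z_n` of database `n` when the messages are `w`. -/
def content (w : Messages K L) (n : 𝒟) : S.stored n → Bool := fun b => w b.1.1 b.1.2

/-- A query to database `n` together with an answer to it. -/
abbrev Transcript (n : 𝒟) : Type := Σ q : S.Query n, (S.Slot n q → Bool)

/-- The pair `(Q_n, A_n)` for the messages `w` and the query `q`. -/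
def transcript (w : Messages K L) (n : 𝒟) (q : S.Query n) : S.Transcript n :=
  ⟨q, S.answer n q (S.content w n)⟩

/-- All queries and answers together determine the requested message, with zero error. -/
def Correct : Prop :=
  ∀ k : Fin K, ∃ decode : (∀ n, S.Transcript n) → (Fin L → Bool),
    ∀ q ∈ (S.queryLaw k).support, ∀ w : Messages K L,
      decode (fun n => S.transcript w n (q n)) = w k

/-- The joint law of `(Q_n, A_n, W_1, …, W_K, (Z_m)_m)` when message `k` is requested; the messages
are independent and uniform, and independent of the queries. -/
noncomputable def viewLaw (k : Fin K) (n : 𝒟) :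
    PMF (S.Transcript n × Messages K L × (∀ m, S.stored m → Bool)) :=
  (S.queryLaw k).bind fun q =>
    (PMF.uniformOfFintype (Messages K L)).map fun w =>
      (S.transcript w n (q n), w, S.content w)

/-- What a single database sees does not depend on which message is requested. -/
def Private : Prop := ∀ (n : 𝒟) (k k' : Fin K), S.viewLaw k n = S.viewLaw k' n

/-- The total number of bits downloaded when the queries are `q`. -/
def bits [Fintype 𝒟] (q : ∀ n, S.Query n) : ℕ := ∑ n, Fintype.card (S.Slot n (q n))

/-- The number `D` of downloaded bits of the scheme. -/
noncomputable def download [Fintype 𝒟] : DownloadConvention → ℝ≥0∞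
  | .average => ⨆ k : Fin K, ∑' q, S.queryLaw k q * (S.bits q : ℝ≥0∞)
  | .worstCase => ⨆ k : Fin K, ⨆ q ∈ (S.queryLaw k).support, (S.bits q : ℝ≥0∞)

/-- The rate `R = L / D`. -/
noncomputable def rate [Fintype 𝒟] (c : DownloadConvention) : ℝ≥0∞ := (L : ℝ≥0∞) / S.download c

/-- A full storage PIR scheme: each database stores all messages. -/
structure IsFS : Prop where
  pos : 0 < L
  full : ∀ n, S.stored n = Finset.univ
  correct : S.Correct
  priv : S.Private

/-- A storage constrained PIR scheme: each database stores at most `μ K L` bits. -/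
structure IsSC (μ : ℝ) : Prop where
  pos : 0 < L
  storage : ∀ n, ((S.stored n).card : ℝ) ≤ μ * K * L
  correct : S.Correct
  priv : S.Private

end PIRScheme

/-- The rates of all full storage PIR schemes, of any message length, for `K` messages and the
databases `𝒟`. The capacity is the largest of them. -/
def fsRates (c : DownloadConvention) (𝒟 : Type) [Fintype 𝒟] (K : ℕ) : Set ℝ≥0∞ :=
  {r | ∃ (L : ℕ) (S : PIRScheme 𝒟 K L), S.IsFS ∧ S.rate c = r}

/-- The rates of all storage constrained PIR schemes, of any message length and with any uncoded
placement, for `K` messages and the databases `𝒟`. The capacity is the largest of them. -/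
def scRates (c : DownloadConvention) (𝒟 : Type) [Fintype 𝒟] (K : ℕ) (μ : ℝ) : Set ℝ≥0∞ :=
  {r | ∃ (L : ℕ) (S : PIRScheme 𝒟 K L), S.IsSC μ ∧ S.rate c = r}

namespace PIRScheme

variable {𝒟 : Type} [Fintype 𝒟] {K L : ℕ} (S : PIRScheme 𝒟 K L)

/-- `S` is a full storage PIR scheme whose rate is the full storage capacity. -/
def IsFSCapacityAchieving (c : DownloadConvention) : Prop :=
  S.IsFS ∧ IsGreatest (fsRates c 𝒟 K) (S.rate c)

/-- `S` is a storage constrained PIR scheme whose rate is the storage constrained capacity. -/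
def IsSCCapacityAchieving (c : DownloadConvention) (μ : ℝ) : Prop :=
  S.IsSC μ ∧ IsGreatest (scRates c 𝒟 K μ) (S.rate c)

end PIRScheme

/-- The law of a tuple of independent random variables with laws `p 0, p 1, …`. -/
noncomputable def independentLaw : {F : ℕ} → {Ω : Fin F → Type} → (∀ f, PMF (Ω f)) →
    PMF (∀ f, Ω f)
  | 0, _, _ => PMF.pure (fun f => f.elim0)
  | _ + 1, _, p => (p 0).bind fun x => (independentLaw fun f => p f.succ).map fun y => Fin.cons x y

/-- The product formula for `independentLaw`. -/
theorem independentLaw_apply {F : ℕ} {Ω : Fin F → Type} (p : ∀ f, PMF (Ω f)) (x : ∀ f, Ω f) :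
    independentLaw p x = ∏ f, p f (x f) := by
  classical
  induction F with
  | zero =>
    have : x = fun f => f.elim0 := funext fun f => f.elim0
    simp [independentLaw, this]
  | succ F ih =>
    rw [independentLaw, PMF.bind_apply, Fin.prod_univ_succ, tsum_eq_single (x 0)]
    · congr 1
      rw [PMF.map_apply, tsum_eq_single (Fin.tail x)]
      · rw [if_pos (Fin.cons_self_tail x).symm, ih]
        rfl
      · intro y hy
        rw [if_neg]
        intro h
        apply hy
        funext f
        have := congrFun h f.succ
        simpa [Fin.tail] using this.symm
    · intro y hy
      rw [PMF.map_apply]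
      have : ∀ z : (∀ f : Fin F, Ω f.succ), x ≠ Fin.cons y z := by
        intro z h
        apply hy
        have := congrFun h 0
        simpa using this.symm
      simp [this]

/-- The storage constrained scheme built from one scheme `S f` for each group `𝒩 f` of databases.
Message `k` is split by `split k` into sub-messages, the `f`-th one of `ℓ f` bits. A database stores
the `f`-th sub-messages of all messages whenever it belongs to `𝒩 f`. The user retrieves the `f`-th
sub-message of the requested message with `S f` from the databases in `𝒩 f`, independently for the
different `f`. -/
noncomputable def PIRScheme.compose {N K L F : ℕ} {ℓ : Fin F → ℕ}
    (split : Fin K → ((Σ f : Fin F, Fin (ℓ f)) ≃ Fin L)) (𝒩 : Fin F → Finset (Fin N))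
    (S : ∀ f, PIRScheme (𝒩 f) K (ℓ f)) : PIRScheme (Fin N) K L where
  stored n := Finset.univ.filter fun b => n ∈ 𝒩 ((split b.1).symm b.2).1
  Query n := ∀ f : {f // n ∈ 𝒩 f}, (S f).Query ⟨n, f.2⟩
  queryLaw k := (independentLaw fun f => (S f).queryLaw k).map fun ω n f => ω f.1 ⟨n, f.2⟩
  Slot n q := Σ f : {f // n ∈ 𝒩 f}, (S f).Slot ⟨n, f.2⟩ (q f)
  slotFintype _ _ := inferInstance
  answer n q z s :=
    (S s.1).answer ⟨n, s.1.2⟩ (q s.1)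
      (fun b => z ⟨(b.1.1, split b.1.1 ⟨s.1.1, b.1.2⟩), by simpa using s.1.2⟩) s.2

/-!
# Capacity-achieving storage constrained PIR from full storage PIR

Write `g m = 1 + 1/m + ⋯ + 1/m^(K-1)` (`invCapacity K m`). Three facts give the theorem.

*The groups do well enough.* There is a full storage scheme for `m` databases with download `L g m`
and the same download for all queries, so it counts under both conventions
(`exists_isFS_download_le`). It matches blocks of the messages with all zero-sum vectors over `ℤ/m`
by a random bijection, so that every database sees each of its possible queries exactly once, in an
order that carries no information. Hence a capacity-achieving scheme for the group `𝒩 f` downloads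
at most `ℓ f * g |𝒩 f|` bits.

*The composed scheme inherits everything.* Correctness, privacy and the bound `∑ f, ℓ f * g |𝒩 f|`
for the download follow from the components (`compose_correct`, `compose_private`,
`compose_download_le`). On either condition on the placement, this sum is `L γ`, where `γ` is the
value at `t = μ N` of the chord of `g` over `[⌊t⌋, ⌊t⌋ + 1]`.

*No scheme does better* (`IsSC.le_download`). If bit `b` is stored at `s b` databases, the download
`D` satisfies `K D ≥ ∑ b, g (s b)`. By convexity of `g` the chord above lies below `g` at all
positive integers, and it decreases, so that `∑ b, s b ≤ t K L` gives `D ≥ L γ`. The bound for `K D`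
is an average over cyclic orders of the messages. For a fixed order one reveals the messages one
after the other and, in between, the contents of the databases: let `T B` be the entropy of all
answers given the first `j` messages and the contents of the databases in `B`, and let `h n` be that
of answer `n` alone. The chain rule gives `T B ≥ h n + T (B ∪ {n})` for each of the `m` databases
`n ∉ B`, and by privacy `∑ n, h n` bounds the entropy of the answers to a request of the next
message. Summing over `n`, a bit stored at `s` of the `m` databases and contributing `x` to the
latter entropy contributes `x / s` to `T B`, because `m (x / s) = x + (m - s) (x / s)`
(`card_mul_residual`). Thus the bits of message `j` in the order contribute `s ^ (-j)` in the end,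
where the count starts at `j = 0`.

Entropies are those of partitions of the finite set of messages, for a fixed realization of the
queries, averaged over the queries afterwards. Since answers are functions of queries and messages,
correctness and privacy become statements about the law of the queries (`correct_iff`,
`private_iff`).
-/

/-! ### Entropy of partitions of a finite uniform space -/

namespace Setoid

variable {Ω : Type*} [Fintype Ω]

/-- The number of points equivalent to `ω`. -/
noncomputable def classSize (r : Setoid Ω) (ω : Ω) : ℕ := by
  classical exact (Finset.univ.filter fun x => r x ω).card

theorem classSize_pos (r : Setoid Ω) (ω : Ω) : 0 < r.classSize ω := by
  classical
  exact Finset.card_pos.2 ⟨ω, by simp⟩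

theorem classSize_mono {r s : Setoid Ω} (h : r ≤ s) (ω : Ω) : r.classSize ω ≤ s.classSize ω := by
  classical
  exact Finset.card_le_card (Finset.monotone_filter_right _ fun _ _ hx => h hx)

theorem classSize_congr (r : Setoid Ω) {x y : Ω} (h : r x y) : r.classSize x = r.classSize y := by
  classical
  unfold classSize
  congr 1
  ext z
  simp only [Finset.mem_filter, Finset.mem_univ, true_and]
  exact ⟨fun hz => r.trans hz h, fun hz => r.trans hz (r.symm h)⟩

theorem classSize_top (ω : Ω) : (⊤ : Setoid Ω).classSize ω = Fintype.card Ω := by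
  classical
  simp [classSize, Setoid.top_def, Finset.card_univ]

/-- The points of one class have total weight `1` when each has the reciprocal of the class size. -/
theorem sum_inv_classSize_le_one (r : Setoid Ω) (A : Finset Ω) (hA : ∀ x ∈ A, ∀ y ∈ A, r x y) :
    ∑ x ∈ A, (r.classSize x : ℝ)⁻¹ ≤ 1 := by
  classical
  rcases A.eq_empty_or_nonempty with rfl | ⟨a, ha⟩
  · simp
  have hpos : (0 : ℝ) < r.classSize a := by exact_mod_cast r.classSize_pos a
  calc ∑ x ∈ A, (r.classSize x : ℝ)⁻¹ = ∑ x ∈ A, (r.classSize a : ℝ)⁻¹ :=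
        Finset.sum_congr rfl fun x hx => by rw [r.classSize_congr (hA x hx a ha)]
    _ = A.card * (r.classSize a : ℝ)⁻¹ := by simp
    _ ≤ r.classSize a * (r.classSize a : ℝ)⁻¹ := by
        gcongr
        exact Finset.card_le_card fun x hx => by simpa using hA x hx a ha
    _ = 1 := mul_inv_cancel₀ hpos.ne'

/-- The conditional entropy `H(r | s)`, in bits, of two partitions of a finite set with the uniform
distribution. A random variable `X` enters through its fibres `Setoid.ker X`, so that `r ⊓ s` is the
joint variable. -/
noncomputable def condEntropy (r s : Setoid Ω) : ℝ :=
  (Fintype.card Ω : ℝ)⁻¹ * ∑ ω, Real.logb 2 (s.classSize ω / (r ⊓ s).classSize ω)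

theorem condEntropy_nonneg (r s : Setoid Ω) : 0 ≤ condEntropy r s := by
  refine mul_nonneg (by positivity) (Finset.sum_nonneg fun ω _ => Real.logb_nonneg one_lt_two ?_)
  rw [one_le_div (by exact_mod_cast classSize_pos _ ω)]
  exact_mod_cast classSize_mono inf_le_right ω

theorem condEntropy_chain (r s t : Setoid Ω) :
    condEntropy (r ⊓ s) t = condEntropy r t + condEntropy s (r ⊓ t) := by
  unfold condEntropy
  rw [← mul_add, ← Finset.sum_add_distrib]
  congr 1
  refine Finset.sum_congr rfl fun ω _ => ?_
  have h (u : Setoid Ω) : (u.classSize ω : ℝ) ≠ 0 := by exact_mod_cast (classSize_pos u ω).ne'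
  rw [← Real.logb_mul (div_ne_zero (h _) (h _)) (div_ne_zero (h _) (h _)),
    div_mul_div_cancel₀ (h _), inf_assoc, inf_left_comm]

theorem condEntropy_eq_zero {r s : Setoid Ω} (h : s ≤ r) : condEntropy r s = 0 := by
  have (ω : Ω) : (s.classSize ω : ℝ) ≠ 0 := by exact_mod_cast (classSize_pos s ω).ne'
  simp [condEntropy, inf_eq_right.2 h, this]

/-- A nonnegative weight of mean at most `1` has nonpositive mean logarithm. -/
theorem _root_.Real.sum_logb_nonpos_of_sum_le_card (f : Ω → ℝ) (hf : ∀ ω, 0 < f ω)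
    (h : ∑ ω, f ω ≤ Fintype.card Ω) : ∑ ω, Real.logb 2 (f ω) ≤ 0 := by
  have h1 : ∑ ω, Real.log (f ω) ≤ 0 :=
    calc ∑ ω, Real.log (f ω) ≤ ∑ ω, (f ω - 1) :=
          Finset.sum_le_sum fun ω _ => Real.log_le_sub_one_of_pos (hf ω)
      _ ≤ 0 := by simpa [Finset.sum_sub_distrib] using h
  simp only [Real.logb, ← Finset.sum_div]
  exact div_nonpos_of_nonpos_of_nonneg h1 (Real.log_nonneg one_le_two)

/-- Conditioning on a finer partition does not increase the entropy. -/
theorem condEntropy_anti (r : Setoid Ω) {s s' : Setoid Ω} (h : s' ≤ s) :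
    condEntropy r s' ≤ condEntropy r s := by
  classical
  have hpos (u : Setoid Ω) (ω : Ω) : (0 : ℝ) < u.classSize ω := by
    exact_mod_cast classSize_pos u ω
  refine mul_le_mul_of_nonneg_left ?_ (by positivity)
  rw [← sub_nonpos, ← Finset.sum_sub_distrib]
  have key : ∑ ω, ((s'.classSize ω : ℝ) / (r ⊓ s').classSize ω) /
      (s.classSize ω / (r ⊓ s).classSize ω) ≤ Fintype.card Ω := by
    -- Write the product of two class sizes as a number of pairs `(x, y)` and sum over `ω` first:
    -- the `ω` that belong to a given pair lie in one class of `r ⊓ s'`.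
    calc ∑ ω, ((s'.classSize ω : ℝ) / (r ⊓ s').classSize ω) /
        (s.classSize ω / (r ⊓ s).classSize ω)
        = ∑ ω, ∑ x, ∑ y, if s' x ω ∧ (r ⊓ s) y ω then
            ((r ⊓ s').classSize ω : ℝ)⁻¹ * (s.classSize ω : ℝ)⁻¹ else 0 := by
          refine Finset.sum_congr rfl fun ω _ => ?_
          rw [← Finset.sum_product', ← Finset.sum_filter, Finset.sum_const, nsmul_eq_mul]
          have : (Finset.univ ×ˢ Finset.univ).filter
              (fun p : Ω × Ω => s' p.1 ω ∧ (r ⊓ s) p.2 ω) =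
              (Finset.univ.filter fun x => s' x ω) ×ˢ
                (Finset.univ.filter fun y => (r ⊓ s) y ω) := by
            ext; simp
          rw [this, Finset.card_product]
          change _ = ((s'.classSize ω * (r ⊓ s).classSize ω : ℕ) : ℝ) * _
          push_cast
          field_simp
      _ = ∑ x, ∑ y, ∑ ω, if s' x ω ∧ (r ⊓ s) y ω then
            ((r ⊓ s').classSize ω : ℝ)⁻¹ * (s.classSize ω : ℝ)⁻¹ else 0 := by
          rw [Finset.sum_comm]
          exact Finset.sum_congr rfl fun x _ => Finset.sum_comm
      _ ≤ ∑ x, ∑ y, if s y x then (s.classSize x : ℝ)⁻¹ else 0 := by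
          refine Finset.sum_le_sum fun x _ => Finset.sum_le_sum fun y _ => ?_
          split_ifs with hxy
          · rw [← Finset.sum_filter]
            calc _ = (∑ ω ∈ Finset.univ.filter (fun ω => s' x ω ∧ (r ⊓ s) y ω),
                    ((r ⊓ s').classSize ω : ℝ)⁻¹) * (s.classSize x : ℝ)⁻¹ := by
                  rw [Finset.sum_mul]
                  refine Finset.sum_congr rfl fun ω hω => ?_
                  rw [s.classSize_congr (h (Finset.mem_filter.1 hω).2.1)]
              _ ≤ 1 * (s.classSize x : ℝ)⁻¹ := by
                  refine mul_le_mul_of_nonneg_right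
                    (sum_inv_classSize_le_one _ _ fun a ha b hb => ?_) (by positivity)
                  have ha := (Finset.mem_filter.1 ha).2
                  have hb := (Finset.mem_filter.1 hb).2
                  exact ⟨r.trans (r.symm ha.2.1) hb.2.1, s'.trans (s'.symm ha.1) hb.1⟩
              _ = _ := one_mul _
          · refine Finset.sum_nonpos fun ω _ => ?_
            rw [if_neg]
            rintro ⟨h1, h2⟩
            exact hxy (s.trans h2.2 (s.symm (h h1)))
      _ = Fintype.card Ω := by
          have (x : Ω) : (∑ y, if s y x then (s.classSize x : ℝ)⁻¹ else 0) = 1 := by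
            rw [← Finset.sum_filter, Finset.sum_const, nsmul_eq_mul]
            exact mul_inv_cancel₀ (hpos s x).ne'
          simp [this]
  have hq (ω : Ω) : 0 < ((s'.classSize ω : ℝ) / (r ⊓ s').classSize ω) :=
    div_pos (hpos _ _) (hpos _ _)
  have hq' (ω : Ω) : 0 < ((s.classSize ω : ℝ) / (r ⊓ s).classSize ω) :=
    div_pos (hpos _ _) (hpos _ _)
  simp only [← Real.logb_div (hq _).ne' (hq' _).ne']
  exact Real.sum_logb_nonpos_of_sum_le_card _ (fun ω => div_pos (hq ω) (hq' ω)) key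

theorem condEntropy_finset_inf_le {ι : Type*} (I : Finset ι) (r : ι → Setoid Ω) (s : Setoid Ω) :
    condEntropy (I.inf r) s ≤ ∑ i ∈ I, condEntropy (r i) s := by
  classical
  induction I using Finset.induction_on with
  | empty => simp [condEntropy_eq_zero (le_top : s ≤ ⊤)]
  | insert i I hi ih =>
    rw [Finset.inf_insert, Finset.sum_insert hi, condEntropy_chain]
    exact add_le_add le_rfl ((condEntropy_anti _ inf_le_right).trans ih)

/-- The entropy of a variable is at most the logarithm of the number of its values. -/
theorem condEntropy_ker_le {β : Type*} [Fintype β] [Nonempty β] (f : Ω → β) (s : Setoid Ω) :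
    condEntropy (ker f) s ≤ Real.logb 2 (Fintype.card β) := by
  classical
  refine (condEntropy_anti _ le_top).trans ?_
  rcases isEmpty_or_nonempty Ω with hΩ | hΩ
  · simpa [condEntropy] using
      Real.logb_nonneg one_lt_two (by exact_mod_cast Fintype.card_pos (α := β))
  have hΩ' : (0 : ℝ) < Fintype.card Ω := by exact_mod_cast Fintype.card_pos
  have hβ : (0 : ℝ) < Fintype.card β := by exact_mod_cast Fintype.card_pos
  have hpos (ω : Ω) : (0 : ℝ) < (ker f).classSize ω := by
    exact_mod_cast classSize_pos _ ω
  have h1 : ∑ ω, ((ker f).classSize ω : ℝ)⁻¹ ≤ Fintype.card β := by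
    rw [← Finset.sum_fiberwise Finset.univ f]
    calc _ ≤ ∑ _b : β, (1 : ℝ) := Finset.sum_le_sum fun b _ =>
          sum_inv_classSize_le_one _ _ fun x hx y hy => by
            rw [ker_def]
            simp_all
      _ = _ := by simp
  have h2 := Real.sum_logb_nonpos_of_sum_le_card
    (fun ω => ((Fintype.card Ω : ℝ) / (ker f).classSize ω) / Fintype.card β)
    (fun ω => div_pos (div_pos hΩ' (hpos ω)) hβ) (by
      rw [← Finset.sum_div, div_le_iff₀ hβ]
      simp only [div_eq_mul_inv, ← Finset.mul_sum]
      gcongr)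
  have h3 (ω : Ω) : Real.logb 2 (((Fintype.card Ω : ℝ) / (ker f).classSize ω) / Fintype.card β) =
      Real.logb 2 ((Fintype.card Ω : ℝ) / (ker f).classSize ω) - Real.logb 2 (Fintype.card β) :=
    Real.logb_div (div_pos hΩ' (hpos ω)).ne' hβ.ne'
  simp only [h3, Finset.sum_sub_distrib, Finset.sum_const, Finset.card_univ, nsmul_eq_mul] at h2
  simp only [condEntropy, inf_top_eq, classSize_top]
  rw [inv_mul_le_iff₀ hΩ']
  linarith

end Setoid

/-! ### Entropy of sets of message bits -/

/-- The partition of the messages according to the values of the bits in `E`. -/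
def agreeOn {K L : ℕ} (E : Finset (Fin K × Fin L)) : Setoid (Messages K L) where
  r w w' := ∀ b ∈ E, w b.1 b.2 = w' b.1 b.2
  iseqv := ⟨fun _ _ _ => rfl, fun h b hb => (h b hb).symm,
    fun h h' b hb => (h b hb).trans (h' b hb)⟩

section agreeOn

variable {K L : ℕ}

theorem agreeOn_apply {E : Finset (Fin K × Fin L)} {w w' : Messages K L} :
    agreeOn E w w' ↔ ∀ b ∈ E, w b.1 b.2 = w' b.1 b.2 := Iff.rfl

theorem agreeOn_inf (E E' : Finset (Fin K × Fin L)) :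
    agreeOn E ⊓ agreeOn E' = agreeOn (E ∪ E') := by
  ext w w'
  simp only [Setoid.inf_def, agreeOn_apply, Pi.inf_apply, inf_Prop_eq, Finset.mem_union]
  exact ⟨fun h b hb => hb.elim (h.1 b) (h.2 b),
    fun h => ⟨fun b hb => h b (.inl hb), fun b hb => h b (.inr hb)⟩⟩

theorem agreeOn_anti {E E' : Finset (Fin K × Fin L)} (h : E ⊆ E') : agreeOn E' ≤ agreeOn E :=
  fun _ _ hw b hb => hw b (h hb)

theorem classSize_agreeOn (E : Finset (Fin K × Fin L)) (w : Messages K L) :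
    (agreeOn E).classSize w = 2 ^ (Eᶜ).card := by
  classical
  have : (Finset.univ.filter fun x => agreeOn E x w) = Fintype.piFinset fun k =>
      Fintype.piFinset fun i => if (k, i) ∈ E then {w k i} else Finset.univ := by
    ext x
    simp only [Finset.mem_filter, Finset.mem_univ, true_and, Fintype.mem_piFinset, agreeOn_apply,
      Prod.forall]
    refine forall₂_congr fun k i => ?_
    split_ifs with h <;> simp [h]
  unfold Setoid.classSize
  simp only [this, Fintype.card_piFinset, apply_ite Finset.card, Finset.card_singleton,
    Finset.card_univ, Fintype.card_bool]
  rw [← Fintype.prod_prod_type' (f := fun k i => if (k, i) ∈ E then 1 else 2)]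
  simp [Finset.prod_ite, Finset.filter_not, Finset.compl_eq_univ_sdiff]

theorem condEntropy_agreeOn (F E : Finset (Fin K × Fin L)) :
    Setoid.condEntropy (agreeOn F) (agreeOn E) = (F \ E).card := by
  have h : (Eᶜ).card = (F \ E).card + ((F ∪ E)ᶜ).card := by
    rw [← Finset.card_union_of_disjoint]
    · congr 1
      ext; simp; tauto
    · rw [Finset.disjoint_left]
      intro x; simp; tauto
  simp only [Setoid.condEntropy, agreeOn_inf, classSize_agreeOn, h, pow_add]
  simp [Real.logb_pow]

end agreeOn

/-! ### Expectations and marginals of discrete laws -/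

namespace PMF

variable {α β : Type*}

theorem tsum_map_mul (p : PMF α) (f : α → β) (g : β → ℝ≥0∞) :
    ∑' b, p.map f b * g b = ∑' a, p a * g (f a) := by
  classical
  simp only [PMF.map_apply, ← ENNReal.tsum_mul_right]
  rw [ENNReal.tsum_comm]
  refine tsum_congr fun a => ?_
  rw [tsum_eq_single (f a) fun b hb => by simp [hb]]
  simp

theorem tsum_mul_const (p : PMF α) (x : ℝ≥0∞) : ∑' a, p a * x = x := by
  rw [ENNReal.tsum_mul_right, p.tsum_coe, one_mul]

theorem tsum_mul_add (p : PMF α) (f g : α → ℝ≥0∞) :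
    ∑' a, p a * (f a + g a) = ∑' a, p a * f a + ∑' a, p a * g a := by
  simp only [mul_add, ENNReal.tsum_add]

theorem tsum_mul_finset_sum {ι : Type*} (p : PMF α) (I : Finset ι) (f : ι → α → ℝ≥0∞) :
    ∑' a, p a * ∑ i ∈ I, f i a = ∑ i ∈ I, ∑' a, p a * f i a := by
  simp only [Finset.mul_sum]
  exact Summable.tsum_finsetSum fun _ _ => ENNReal.summable

theorem tsum_mul_le_of_forall_mem_support (p : PMF α) {f g : α → ℝ≥0∞}
    (h : ∀ a ∈ p.support, f a ≤ g a) : ∑' a, p a * f a ≤ ∑' a, p a * g a := by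
  refine ENNReal.tsum_le_tsum fun a => ?_
  by_cases ha : a ∈ p.support
  · gcongr
    exact h a ha
  · simp [(p.apply_eq_zero_iff a).2 ha]

end PMF

section independentLaw

theorem mem_support_independentLaw {F : ℕ} {Ω : Fin F → Type} (p : ∀ f, PMF (Ω f)) (x : ∀ f, Ω f) :
    x ∈ (independentLaw p).support ↔ ∀ f, x f ∈ (p f).support := by
  simp only [PMF.mem_support_iff, independentLaw_apply, ne_eq, Finset.prod_eq_zero_iff,
    Finset.mem_univ, true_and, not_exists]

theorem independentLaw_map {F : ℕ} {Ω Ω' : Fin F → Type} (p : ∀ f, PMF (Ω f))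
    (g : ∀ f, Ω f → Ω' f) :
    (independentLaw p).map (fun x f => g f (x f)) = independentLaw fun f => (p f).map (g f) := by
  induction F with
  | zero =>
    rw [independentLaw, independentLaw, PMF.pure_map]
    congr 1
    funext f
    exact f.elim0
  | succ F ih =>
    simp only [independentLaw, PMF.map_bind, PMF.bind_map]
    congr 1
    funext x
    simp only [Function.comp_apply]
    rw [← ih, PMF.map_comp, PMF.map_comp]
    congr 1
    funext y f
    refine Fin.cases ?_ (fun f => ?_) f <;> simp

theorem independentLaw_map_eval {F : ℕ} {Ω : Fin F → Type} (p : ∀ f, PMF (Ω f)) (f : Fin F) :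
    (independentLaw p).map (fun x => x f) = p f := by
  induction F with
  | zero => exact f.elim0
  | succ F ih =>
    simp only [independentLaw, PMF.map_bind, PMF.map_comp]
    refine Fin.cases ?_ (fun f => ?_) f
    · have (x : Ω 0) : ((fun z : ∀ f, Ω f => z 0) ∘
          fun y => (Fin.cons x y : ∀ f, Ω f)) = Function.const _ x := rfl
      simp only [this, PMF.map_const, PMF.bind_pure]
    · have (x : Ω 0) : ((fun z : ∀ f, Ω f => z f.succ) ∘
          fun y => (Fin.cons x y : ∀ f, Ω f)) = fun y => y f := rfl
      simp only [this, ih (fun f => p f.succ), PMF.bind_const]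

end independentLaw

/-! ### Correctness, privacy and download of a scheme -/

namespace PIRScheme

variable {𝒟 : Type} {K L : ℕ} (S : PIRScheme 𝒟 K L)

/-- Since a transcript contains the query, a decoder exists as soon as, for each possible query, the
answers determine the requested message. -/
theorem correct_iff : S.Correct ↔ ∀ k, ∀ q ∈ (S.queryLaw k).support, ∀ w w' : Messages K L,
    (∀ n, S.answer n (q n) (S.content w n) = S.answer n (q n) (S.content w' n)) →
      w k = w' k := by
  classical
  constructor
  · intro h k q hq w w' hw
    obtain ⟨d, hd⟩ := h k
    rw [← hd q hq w, ← hd q hq w']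
    congr 1
    funext n
    rw [transcript, transcript, hw n]
  · intro h k
    refine ⟨fun T => if hT : ∃ q ∈ (S.queryLaw k).support, ∃ w,
      (fun n => S.transcript w n (q n)) = T then hT.choose_spec.2.choose k else fun _ => false,
      fun q hq w => ?_⟩
    have hT : ∃ q' ∈ (S.queryLaw k).support, ∃ w',
      (fun n => S.transcript w' n (q' n)) = fun n => S.transcript w n (q n) := ⟨q, hq, w, rfl⟩
    refine (dif_pos hT).trans ?_
    have key (q' : ∀ n, S.Query n) (w' : Messages K L)
        (hw : (fun n => S.transcript w' n (q' n)) = fun n => S.transcript w n (q n)) :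
        w' k = w k := by
      have hqq : q' = q := funext fun n => congrArg Sigma.fst (congrFun hw n)
      subst hqq
      exact h k _ hq w' w fun n => eq_of_heq (Sigma.mk.inj (congrFun hw n)).2
    exact key _ _ hT.choose_spec.2.choose_spec

/-- Since an answer is a function of the query and of the messages, a scheme is private as soon as
the law of the query to each database does not depend on the request. -/
theorem private_iff : S.Private ↔ ∀ n k k',
    (S.queryLaw k).map (fun q => q n) = (S.queryLaw k').map (fun q => q n) := by
  constructor
  · intro h n k k'
    have key (k) : (S.viewLaw k n).map (fun v => v.1.1) = (S.queryLaw k).map (fun q => q n) := by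
      simp only [viewLaw, PMF.map_bind, PMF.map_comp]
      have (q : ∀ n, S.Query n) : ((fun v : S.Transcript n × Messages K L ×
          (∀ m, S.stored m → Bool) => v.1.1) ∘ fun w => (S.transcript w n (q n), w, S.content w)) =
          Function.const _ (q n) := rfl
      simp only [this, PMF.map_const]
      rfl
    rw [← key, ← key, h n k k']
  · intro h n k k'
    have key (k) : S.viewLaw k n = ((S.queryLaw k).map fun q => q n).bind fun x =>
        (PMF.uniformOfFintype (Messages K L)).map fun w =>
          (S.transcript w n x, w, S.content w) := by
      rw [PMF.bind_map]
      rfl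
    rw [key, key, h n k k']

/-- In a correct scheme every message bit is stored at some database. -/
theorem Correct.exists_mem_stored {S : PIRScheme 𝒟 K L} (h : S.Correct) (b : Fin K × Fin L) :
    ∃ n, b ∈ S.stored n := by
  classical
  by_contra! hb
  obtain ⟨q, hq⟩ := (S.queryLaw b.1).support_nonempty
  have := S.correct_iff.1 h b.1 q hq (fun _ _ => false)
    (fun k i => if (k, i) = b then true else false) fun n => by
      congr 1
      funext x
      have : (x.1.1, x.1.2) ≠ b := fun hx => hb n (hx ▸ x.2)
      simp only [content, if_neg this]
  simpa using congrFun this b.2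

variable [Fintype 𝒟]

/-- Under either convention the number of downloaded bits is at least its expectation. -/
theorem tsum_bits_le_download (c : DownloadConvention) (k : Fin K) :
    ∑' q, S.queryLaw k q * (S.bits q : ℝ≥0∞) ≤ S.download c := by
  cases c with
  | average => exact le_iSup (fun k => ∑' q, S.queryLaw k q * (S.bits q : ℝ≥0∞)) k
  | worstCase =>
    refine le_trans ?_ (le_iSup _ k)
    rw [← (S.queryLaw k).tsum_mul_const (⨆ q ∈ (S.queryLaw k).support, (S.bits q : ℝ≥0∞))]
    exact PMF.tsum_mul_le_of_forall_mem_support _ fun q hq =>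
      le_iSup₂ (f := fun q _ => (S.bits q : ℝ≥0∞)) q hq

theorem download_le_of_bits_le (c : DownloadConvention) (D : ℝ≥0∞)
    (h : ∀ k, ∀ q ∈ (S.queryLaw k).support, (S.bits q : ℝ≥0∞) ≤ D) : S.download c ≤ D := by
  cases c with
  | average =>
    refine iSup_le fun k => ?_
    rw [← (S.queryLaw k).tsum_mul_const D]
    exact PMF.tsum_mul_le_of_forall_mem_support _ (h k)
  | worstCase => exact iSup_le fun k => iSup₂_le (h k)

end PIRScheme

/-! ### The download forced by a given placement -/

namespace PIRScheme

variable {𝒟 : Type} {K L : ℕ} (S : PIRScheme 𝒟 K L)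

/-- The partition of the messages according to the answer of database `n` to the query `x`. -/
def answerPartition (n : 𝒟) (x : S.Query n) : Setoid (Messages K L) :=
  Setoid.ker fun w => S.answer n x (S.content w n)

theorem agreeOn_le_answerPartition {n : 𝒟} (x : S.Query n) {E : Finset (Fin K × Fin L)}
    (h : S.stored n ⊆ E) : agreeOn E ≤ S.answerPartition n x := by
  intro w w' hw
  rw [answerPartition, Setoid.ker_def]
  congr 1
  funext b
  exact hw _ (h b.2)

theorem condEntropy_answerPartition_le (n : 𝒟) (x : S.Query n) (s : Setoid (Messages K L)) :
    (S.answerPartition n x).condEntropy s ≤ Fintype.card (S.Slot n x) := by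
  classical
  refine (Setoid.condEntropy_ker_le _ s).trans_eq ?_
  simp [Real.logb_pow]

/-- The expected conditional entropy of one answer, when message `k` is requested, given the
queries and the message bits in `E`. -/
noncomputable def singleAnswerEntropy (k : Fin K) (n : 𝒟) (E : Finset (Fin K × Fin L)) : ℝ≥0∞ :=
  ∑' q, S.queryLaw k q * ENNReal.ofReal ((S.answerPartition n (q n)).condEntropy (agreeOn E))

/-- This is where privacy enters. -/
theorem Private.singleAnswerEntropy_eq {S : PIRScheme 𝒟 K L} (hS : S.Private) (k k' : Fin K)
    (n : 𝒟) (E : Finset (Fin K × Fin L)) :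
    S.singleAnswerEntropy k n E = S.singleAnswerEntropy k' n E := by
  have key (k) : S.singleAnswerEntropy k n E = ∑' x, (S.queryLaw k).map (fun q => q n) x *
      ENNReal.ofReal ((S.answerPartition n x).condEntropy (agreeOn E)) :=
    (PMF.tsum_map_mul (S.queryLaw k) (fun q => q n) fun x =>
      ENNReal.ofReal ((S.answerPartition n x).condEntropy (agreeOn E))).symm
  rw [key, key, S.private_iff.1 hS n k k']

/-- With the messages in the order `σ`, the bits of the first `j` messages together with the bits
stored in `B`. -/
noncomputable def known (σ : Equiv.Perm (Fin K)) (j : ℕ) (B : Finset 𝒟) :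
    Finset (Fin K × Fin L) := by
  classical exact Finset.univ.filter fun b => (σ b.1 : ℕ) < j ∨ ∃ n ∈ B, b ∈ S.stored n

theorem mem_known {S : PIRScheme 𝒟 K L} {σ : Equiv.Perm (Fin K)} {j : ℕ} {B : Finset 𝒟}
    {b : Fin K × Fin L} : b ∈ S.known σ j B ↔ (σ b.1 : ℕ) < j ∨ ∃ n ∈ B, b ∈ S.stored n := by
  simp [known]

theorem known_insert [DecidableEq 𝒟] (σ : Equiv.Perm (Fin K)) (j : ℕ) (B : Finset 𝒟) (n : 𝒟) :
    S.known σ j (insert n B) = S.known σ j B ∪ S.stored n := by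
  ext b
  simp only [mem_known, Finset.mem_union, Finset.exists_mem_insert]
  rw [or_comm (a := b ∈ S.stored n), or_assoc]

theorem known_succ (σ : Equiv.Perm (Fin K)) (k : Fin K) (B : Finset 𝒟) :
    (Finset.univ.filter fun b : Fin K × Fin L => b.1 = k) ∪ S.known σ (σ k) B =
      S.known σ (σ k + 1) B := by
  ext b
  have : b.1 = k ↔ (σ b.1 : ℕ) = σ k := by rw [← Fin.ext_iff, σ.injective.eq_iff]
  simp only [mem_known, Finset.mem_union, Finset.mem_filter, Finset.mem_univ, true_and, this,
    Order.lt_add_one_iff, le_iff_eq_or_lt]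
  tauto

/-- The number of databases that store a message bit. -/
noncomputable def multiplicity [Fintype 𝒟] (b : Fin K × Fin L) : ℕ := by
  classical exact (Finset.univ.filter fun n => b ∈ S.stored n).card

theorem sum_multiplicity [Fintype 𝒟] : ∑ b, S.multiplicity b = ∑ n, (S.stored n).card := by
  classical
  simp only [multiplicity, Finset.card_filter]
  rw [Finset.sum_comm]
  simp

theorem Correct.multiplicity_pos [Fintype 𝒟] {S : PIRScheme 𝒟 K L} (h : S.Correct)
    (b : Fin K × Fin L) : 0 < S.multiplicity b := by
  classical
  obtain ⟨n, hn⟩ := h.exists_mem_stored b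
  exact Finset.card_pos.2 ⟨n, by simpa using hn⟩

variable [Fintype 𝒟]

/-- The partition of the messages according to the answers of all databases. -/
def allAnswers (q : ∀ n, S.Query n) : Setoid (Messages K L) :=
  Finset.univ.inf fun n => S.answerPartition n (q n)

/-- Revealing one answer, and then all that its database stores, leaves at most the entropy that
all answers have. -/
theorem condEntropy_add_le_condEntropy_allAnswers (q : ∀ n, S.Query n) (n : 𝒟)
    (E : Finset (Fin K × Fin L)) :
    (S.answerPartition n (q n)).condEntropy (agreeOn E) +
      (S.allAnswers q).condEntropy (agreeOn (E ∪ S.stored n)) ≤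
        (S.allAnswers q).condEntropy (agreeOn E) := by
  have h : S.allAnswers q = S.answerPartition n (q n) ⊓ S.allAnswers q :=
    (inf_eq_right.2 (Finset.inf_le (Finset.mem_univ n))).symm
  conv_rhs => rw [h, Setoid.condEntropy_chain]
  gcongr
  exact Setoid.condEntropy_anti _ (le_inf
    (S.agreeOn_le_answerPartition _ Finset.subset_union_right)
    (agreeOn_anti Finset.subset_union_left))

theorem condEntropy_allAnswers_le (q : ∀ n, S.Query n) (I : Finset 𝒟)
    (E : Finset (Fin K × Fin L)) (h : ∀ n ∉ I, S.stored n ⊆ E) :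
    (S.allAnswers q).condEntropy (agreeOn E) ≤
      ∑ n ∈ I, (S.answerPartition n (q n)).condEntropy (agreeOn E) := by
  classical
  refine (Setoid.condEntropy_finset_inf_le _ _ _).trans_eq
    (Finset.sum_subset (Finset.subset_univ I) fun n _ hn => ?_).symm
  exact Setoid.condEntropy_eq_zero (S.agreeOn_le_answerPartition _ (h n hn))

/-- The requested message accounts for one bit of entropy per unknown bit. -/
theorem condEntropy_allAnswers_eq (hS : S.Correct) (k : Fin K) {q : ∀ n, S.Query n}
    (hq : q ∈ (S.queryLaw k).support) (E : Finset (Fin K × Fin L)) :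
    (S.allAnswers q).condEntropy (agreeOn E) =
      ((Finset.univ.filter fun b : Fin K × Fin L => b.1 = k) \ E).card +
        (S.allAnswers q).condEntropy
          (agreeOn ((Finset.univ.filter fun b : Fin K × Fin L => b.1 = k) ∪ E)) := by
  have h : S.allAnswers q ≤ agreeOn (Finset.univ.filter fun b : Fin K × Fin L => b.1 = k) := by
    intro w w' hw b hb
    have hw' (n) : S.answer n (q n) (S.content w n) = S.answer n (q n) (S.content w' n) :=
      (Finset.inf_le (Finset.mem_univ n) :
        S.allAnswers q ≤ S.answerPartition n (q n)) hw
    have := S.correct_iff.1 hS k q hq w w' hw'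
    rw [(Finset.mem_filter.1 hb).2, this]
  conv_lhs => rw [← inf_eq_right.2 h, Setoid.condEntropy_chain]
  rw [condEntropy_agreeOn, agreeOn_inf]

/-- The expected conditional entropy of all answers, when message `k` is requested, given the
queries and the message bits in `E`. -/
noncomputable def answerEntropy (k : Fin K) (E : Finset (Fin K × Fin L)) : ℝ≥0∞ :=
  ∑' q, S.queryLaw k q * ENNReal.ofReal ((S.allAnswers q).condEntropy (agreeOn E))

theorem singleAnswerEntropy_add_le (k : Fin K) (n : 𝒟) (E : Finset (Fin K × Fin L)) :
    S.singleAnswerEntropy k n E + S.answerEntropy k (E ∪ S.stored n) ≤ S.answerEntropy k E := by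
  rw [singleAnswerEntropy, answerEntropy, answerEntropy, ← PMF.tsum_mul_add]
  refine PMF.tsum_mul_le_of_forall_mem_support _ fun q _ => ?_
  rw [← ENNReal.ofReal_add (Setoid.condEntropy_nonneg _ _) (Setoid.condEntropy_nonneg _ _)]
  exact ENNReal.ofReal_le_ofReal (S.condEntropy_add_le_condEntropy_allAnswers q n E)

theorem answerEntropy_le_sum (k : Fin K) (I : Finset 𝒟) (E : Finset (Fin K × Fin L))
    (h : ∀ n ∉ I, S.stored n ⊆ E) :
    S.answerEntropy k E ≤ ∑ n ∈ I, S.singleAnswerEntropy k n E := by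
  simp only [singleAnswerEntropy, answerEntropy]
  rw [← PMF.tsum_mul_finset_sum]
  refine PMF.tsum_mul_le_of_forall_mem_support _ fun q _ => ?_
  rw [← ENNReal.ofReal_sum_of_nonneg fun _ _ => Setoid.condEntropy_nonneg _ _]
  exact ENNReal.ofReal_le_ofReal (S.condEntropy_allAnswers_le q I E h)

theorem Correct.answerEntropy_eq {S : PIRScheme 𝒟 K L} (hS : S.Correct) (k : Fin K)
    (E : Finset (Fin K × Fin L)) :
    S.answerEntropy k E = ((Finset.univ.filter fun b : Fin K × Fin L => b.1 = k) \ E).card +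
      S.answerEntropy k ((Finset.univ.filter fun b : Fin K × Fin L => b.1 = k) ∪ E) := by
  rw [answerEntropy, answerEntropy,
    ← (S.queryLaw k).tsum_mul_const (Finset.card _ : ℝ≥0∞), ← PMF.tsum_mul_add]
  refine tsum_congr fun q => ?_
  by_cases hq : q ∈ (S.queryLaw k).support
  · rw [S.condEntropy_allAnswers_eq hS k hq,
      ENNReal.ofReal_add (Nat.cast_nonneg _) (Setoid.condEntropy_nonneg _ _),
      ENNReal.ofReal_natCast]
  · simp [((S.queryLaw k).apply_eq_zero_iff q).2 hq]

theorem answerEntropy_le_tsum_bits (k : Fin K) (E : Finset (Fin K × Fin L)) :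
    S.answerEntropy k E ≤ ∑' q, S.queryLaw k q * (S.bits q : ℝ≥0∞) := by
  refine PMF.tsum_mul_le_of_forall_mem_support _ fun q _ => ENNReal.ofReal_le_of_le_toReal ?_
  rw [ENNReal.toReal_natCast, bits, Nat.cast_sum]
  exact (Setoid.condEntropy_finset_inf_le _ _ _).trans
    (Finset.sum_le_sum fun n _ => S.condEntropy_answerPartition_le _ _ _)

/-- The lower bound for the entropy of the answers given `S.known σ j B`: an unknown bit of the
`i`-th message (in the order `σ`) that is stored `s` times contributes `s ^ (-(i - j + e))`. Here
`e = 0` is for a request of the `j`-th message and `e = 1` for an arbitrary request. -/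
noncomputable def residual (σ : Equiv.Perm (Fin K)) (j e : ℕ) (B : Finset 𝒟) : ℝ≥0∞ :=
  ∑ b ∈ (S.known σ j B)ᶜ, ((S.multiplicity b : ℝ≥0∞)⁻¹) ^ ((σ b.1 : ℕ) - j + e)

theorem residual_zero (σ : Equiv.Perm (Fin K)) (k : Fin K) (B : Finset 𝒟) :
    S.residual σ (σ k) 0 B =
      ((Finset.univ.filter fun b : Fin K × Fin L => b.1 = k) \ S.known σ (σ k) B).card +
        S.residual σ (σ k + 1) 1 B := by
  classical
  have h : (S.known σ (σ k) B)ᶜ =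
      ((Finset.univ.filter fun b : Fin K × Fin L => b.1 = k) \ S.known σ (σ k) B) ∪
        (S.known σ (σ k + 1) B)ᶜ := by
    rw [← known_succ]
    ext b
    simp only [Finset.mem_compl, Finset.mem_union, Finset.mem_sdiff]
    tauto
  rw [residual, h, Finset.sum_union, residual]
  · congr 1
    · rw [Finset.sum_congr rfl (g := fun _ => 1)]
      · simp
      · intro b hb
        simp only [Finset.mem_sdiff, Finset.mem_filter, Finset.mem_univ, true_and] at hb
        simp [hb.1]
    · refine Finset.sum_congr rfl fun b hb => ?_
      simp only [Finset.mem_compl, mem_known, not_or, not_lt] at hb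
      congr 1
      lia
  · rw [← known_succ, Finset.disjoint_left]
    intro b hb
    rw [Finset.mem_compl, not_not]
    exact Finset.mem_union_left _ (Finset.mem_sdiff.1 hb).1

/-- The recursion that produces the exponents: among the databases outside `B`, an unknown bit is
stored at `s`, and it remains unknown when one of the others is added to `B`. -/
theorem card_mul_residual [DecidableEq 𝒟] (hS : S.Correct) (σ : Equiv.Perm (Fin K)) (j : ℕ)
    (B : Finset 𝒟) :
    (Bᶜ.card : ℝ≥0∞) * S.residual σ j 1 B =
      S.residual σ j 0 B + ∑ n ∈ Bᶜ, S.residual σ j 1 (insert n B) := by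
  classical
  have h1 (n : 𝒟) : S.residual σ j 1 (insert n B) = ∑ b ∈ (S.known σ j B)ᶜ,
      if b ∉ S.stored n then ((S.multiplicity b : ℝ≥0∞)⁻¹) ^ ((σ b.1 : ℕ) - j + 1) else 0 := by
    rw [residual, ← Finset.sum_filter]
    congr 1
    ext b
    simp [known_insert]
  simp only [h1]
  rw [Finset.sum_comm, residual, residual, Finset.mul_sum, ← Finset.sum_add_distrib]
  refine Finset.sum_congr rfl fun b hb => ?_
  simp only [Finset.mem_compl, mem_known, not_or, not_exists, not_and] at hb
  have h2 : S.multiplicity b = (Bᶜ.filter fun n => b ∈ S.stored n).card := by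
    unfold multiplicity
    congr 1
    ext n
    simp only [Finset.mem_filter, Finset.mem_univ, true_and, Finset.mem_compl]
    exact ⟨fun h => ⟨fun hn => hb.2 n hn h, h⟩, fun h => h.2⟩
  have h3 : (Bᶜ.card : ℝ≥0∞) = S.multiplicity b + (Bᶜ.filter fun n => b ∉ S.stored n).card := by
    rw [h2, ← Nat.cast_add, Finset.card_filter_add_card_filter_not]
  have h4 : (S.multiplicity b : ℝ≥0∞) * (S.multiplicity b : ℝ≥0∞)⁻¹ = 1 :=
    ENNReal.mul_inv_cancel (by exact_mod_cast (hS.multiplicity_pos b).ne')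
      (ENNReal.natCast_ne_top _)
  rw [h3, add_mul, ← Finset.sum_filter, Finset.sum_const, nsmul_eq_mul, pow_succ', ← mul_assoc,
    h4, one_mul, add_zero]

/-- One round of the converse: a bound for the requests of message `k` carries over, weakened by the
recursion `card_mul_residual`, to all requests. -/
theorem residual_one_le_of_residual_zero_le (hS : S.Correct) (hP : S.Private)
    (σ : Equiv.Perm (Fin K)) (j : ℕ) (k : Fin K)
    (h : ∀ B, S.residual σ j 0 B ≤ S.answerEntropy k (S.known σ j B))
    (k' : Fin K) (B : Finset 𝒟) :
    S.residual σ j 1 B ≤ S.answerEntropy k' (S.known σ j B) := by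
  classical
  induction hm : Bᶜ.card generalizing B with
  | zero =>
    have : (S.known σ j B)ᶜ = ∅ := by
      ext b
      obtain ⟨n, hn⟩ := hS.exists_mem_stored b
      have hB : n ∈ B := by
        rw [Finset.card_eq_zero, Finset.compl_eq_empty_iff] at hm
        simp [hm]
      simp only [Finset.mem_compl, mem_known, Finset.notMem_empty, iff_false, not_not]
      exact Or.inr ⟨n, hB, hn⟩
    simp [residual, this]
  | succ m ih =>
    have hm0 : (Bᶜ.card : ℝ≥0∞) ≠ 0 := by rw [hm]; simp
    refine (ENNReal.mul_le_mul_iff_right hm0 (ENNReal.natCast_ne_top _)).1 ?_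
    rw [S.card_mul_residual hS]
    calc S.residual σ j 0 B + ∑ n ∈ Bᶜ, S.residual σ j 1 (insert n B)
        ≤ ∑ n ∈ Bᶜ, S.singleAnswerEntropy k n (S.known σ j B) +
            ∑ n ∈ Bᶜ, S.answerEntropy k' (S.known σ j (insert n B)) := by
          refine add_le_add ((h B).trans (S.answerEntropy_le_sum k _ _ fun n hn b hb => ?_))
            (Finset.sum_le_sum fun n hn => ih _ ?_)
          · exact mem_known.2 (.inr ⟨n, by simpa using hn, hb⟩)
          · have h1 : n ∉ B := by simpa using hn
            have h2 := Finset.card_compl_add_card B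
            have h3 := Finset.card_compl_add_card (insert n B)
            rw [Finset.card_insert_of_notMem h1] at h3
            lia
      _ = ∑ n ∈ Bᶜ, (S.singleAnswerEntropy k' n (S.known σ j B) +
            S.answerEntropy k' (S.known σ j B ∪ S.stored n)) := by
          rw [← Finset.sum_add_distrib]
          refine Finset.sum_congr rfl fun n _ => ?_
          rw [hP.singleAnswerEntropy_eq k k', known_insert]
      _ ≤ ∑ n ∈ Bᶜ, S.answerEntropy k' (S.known σ j B) :=
          Finset.sum_le_sum fun n _ => S.singleAnswerEntropy_add_le k' n _
      _ = _ := by rw [Finset.sum_const, nsmul_eq_mul]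

theorem residual_zero_le_answerEntropy (hS : S.Correct) (σ : Equiv.Perm (Fin K)) (k : Fin K)
    (B : Finset 𝒟) (h : S.residual σ (σ k + 1) 1 B ≤
      S.answerEntropy k (S.known σ (σ k + 1) B)) :
    S.residual σ (σ k) 0 B ≤ S.answerEntropy k (S.known σ (σ k) B) := by
  rw [residual_zero, hS.answerEntropy_eq, known_succ]
  gcongr

/-- All rounds of the converse, starting from the situation in which all messages are known. -/
theorem residual_one_le_answerEntropy (hS : S.Correct) (hP : S.Private)
    (σ : Equiv.Perm (Fin K)) {j : ℕ} (hj : j ≤ K) (k : Fin K) (B : Finset 𝒟) :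
    S.residual σ j 1 B ≤ S.answerEntropy k (S.known σ j B) := by
  induction hj using Nat.decreasingInduction generalizing k B with
  | self =>
    have : (S.known σ K B)ᶜ = ∅ := by
      ext b
      simp [mem_known]
    simp [residual, this]
  | of_succ j hj ih =>
    obtain ⟨k', hk'⟩ := σ.surjective ⟨j, hj⟩
    have hk : (σ k' : ℕ) = j := congrArg Fin.val hk'
    refine S.residual_one_le_of_residual_zero_le hS hP σ j k' (fun B => ?_) k B
    have := S.residual_zero_le_answerEntropy hS σ k' B
    rw [hk] at this
    exact this (ih k' B)

/-- The converse for one order of the messages. -/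
theorem sum_inv_multiplicity_pow_le_download (c : DownloadConvention) (hS : S.Correct)
    (hP : S.Private) (σ : Equiv.Perm (Fin K)) (k : Fin K) (hk : (σ k : ℕ) = 0) :
    ∑ b, ((S.multiplicity b : ℝ≥0∞)⁻¹) ^ (σ b.1 : ℕ) ≤ S.download c := by
  have h1 : S.known σ 0 ∅ = ∅ := by
    ext b
    simp [mem_known]
  have h2 := S.residual_zero_le_answerEntropy hS σ k ∅
    (S.residual_one_le_answerEntropy hS hP σ (σ k).2 k ∅)
  rw [hk, residual, h1] at h2
  simpa using h2.trans ((S.answerEntropy_le_tsum_bits k _).trans (S.tsum_bits_le_download c k))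

/-- The average of `sum_inv_multiplicity_pow_le_download` over the cyclic orders of the messages. -/
theorem sum_geom_inv_multiplicity_le (c : DownloadConvention) (hS : S.Correct)
    (hP : S.Private) :
    ∑ b, ∑ i ∈ Finset.range K, ((S.multiplicity b : ℝ≥0∞)⁻¹) ^ i ≤ K * S.download c := by
  rcases Nat.eq_zero_or_pos K with rfl | hK
  · simp
  have : NeZero K := ⟨hK.ne'⟩
  calc ∑ b, ∑ i ∈ Finset.range K, ((S.multiplicity b : ℝ≥0∞)⁻¹) ^ i
      = ∑ b, ∑ a : Fin K, ((S.multiplicity b : ℝ≥0∞)⁻¹) ^ ((b.1 - a : Fin K) : ℕ) := by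
        refine Finset.sum_congr rfl fun b _ => ?_
        rw [← Fin.sum_univ_eq_sum_range, ← (Equiv.subLeft b.1).sum_comp]
        rfl
    _ = ∑ a : Fin K, ∑ b, ((S.multiplicity b : ℝ≥0∞)⁻¹) ^ ((b.1 - a : Fin K) : ℕ) :=
        Finset.sum_comm
    _ ≤ ∑ a : Fin K, S.download c := Finset.sum_le_sum fun a _ =>
        S.sum_inv_multiplicity_pow_le_download c hS hP (Equiv.subRight a) a (by simp)
    _ = K * S.download c := by simp

end PIRScheme

/-! ### The converse bound -/

/-- `1 + 1/m + ⋯ + 1/m^(K-1)`, the reciprocal of the full storage capacity for `K` messages and `m`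
databases. -/
noncomputable def invCapacity (K m : ℕ) : ℝ := ∑ i ∈ Finset.range K, ((m : ℝ)⁻¹) ^ i

theorem invCapacity_pos {K : ℕ} (hK : 0 < K) (m : ℕ) : 0 < invCapacity K m := by
  obtain ⟨K, rfl⟩ := Nat.exists_eq_succ_of_ne_zero hK.ne'
  rw [invCapacity, Finset.sum_range_succ']
  positivity

theorem invCapacity_anti (K : ℕ) {m m' : ℕ} (hm : 0 < m) (h : m ≤ m') :
    invCapacity K m' ≤ invCapacity K m := by
  unfold invCapacity
  gcongr

/-- The chord of a convex function between consecutive integers lies below it at the others. -/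
theorem ConvexOn.add_mul_sub_le_of_nat {f : ℝ → ℝ} (hf : ConvexOn ℝ (Set.Ioi 0) f) {m s : ℕ}
    (hm : 0 < m) (hs : 0 < s) :
    f m + ((s : ℝ) - m) * (f ((m + 1 : ℕ) : ℝ) - f m) ≤ f s := by
  have hm' : (m : ℝ) ∈ Set.Ioi (0 : ℝ) := by simpa using hm
  have hm'' : ((m + 1 : ℕ) : ℝ) ∈ Set.Ioi (0 : ℝ) := by simp only [Set.mem_Ioi]; positivity
  have hs' : (s : ℝ) ∈ Set.Ioi (0 : ℝ) := by simpa using hs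
  have hmm : (m : ℝ) < ((m + 1 : ℕ) : ℝ) := by push_cast; linarith
  rcases lt_trichotomy s m with h | rfl | h
  · have h' : (s : ℝ) < m := by exact_mod_cast h
    have := hf.slope_mono_adjacent hs' hm'' h' hmm
    rw [div_le_iff₀ (by linarith)] at this
    push_cast at this ⊢
    rw [add_sub_cancel_left, div_one] at this
    linarith
  · simp
  · rcases (Nat.succ_le_of_lt h).eq_or_lt with rfl | h
    · push_cast
      linarith
    · have h' : ((m + 1 : ℕ) : ℝ) < s := by exact_mod_cast h
      have := hf.slope_mono_adjacent hm' hs' hmm h'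
      rw [le_div_iff₀ (by linarith)] at this
      push_cast at this ⊢
      rw [add_sub_cancel_left, div_one] at this
      linarith

theorem invCapacity_chord_le (K : ℕ) {m s : ℕ} (hm : 0 < m) (hs : 0 < s) :
    invCapacity K m + ((s : ℝ) - m) * (invCapacity K (m + 1) - invCapacity K m) ≤
      invCapacity K s := by
  simp only [invCapacity, ← Finset.sum_sub_distrib, Finset.mul_sum, ← Finset.sum_add_distrib]
  refine Finset.sum_le_sum fun i _ => ?_
  have h : ConvexOn ℝ (Set.Ioi 0) fun x : ℝ => (x⁻¹) ^ i := by
    refine (convexOn_zpow (-(i : ℤ))).congr fun x _ => ?_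
    simp
  exact h.add_mul_sub_le_of_nat hm hs

/-- The converse: the reciprocal rate is at least the piecewise linear interpolation of
`invCapacity K` at `μ` times the number of databases. The bound holds for each chord; it is the
strongest for the chord above that point. -/
theorem PIRScheme.IsSC.le_download {𝒟 : Type} [Fintype 𝒟] {K L : ℕ} {S : PIRScheme 𝒟 K L} {μ : ℝ}
    (hS : S.IsSC μ) (c : DownloadConvention) (hK : 0 < K) {m : ℕ} (hm : 0 < m) :
    ENNReal.ofReal (L * (invCapacity K m +
      (μ * Fintype.card 𝒟 - m) * (invCapacity K (m + 1) - invCapacity K m))) ≤ S.download c := by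
  have hK0 : (K : ℝ≥0∞) ≠ 0 := by exact_mod_cast hK.ne'
  refine (ENNReal.mul_le_mul_iff_right hK0 (ENNReal.natCast_ne_top K)).1
    (le_trans ?_ (S.sum_geom_inv_multiplicity_le c hS.correct hS.priv))
  have h1 (b) : ∑ i ∈ Finset.range K, ((S.multiplicity b : ℝ≥0∞)⁻¹) ^ i =
      ENNReal.ofReal (invCapacity K (S.multiplicity b)) := by
    have : (0 : ℝ) < S.multiplicity b := by exact_mod_cast hS.correct.multiplicity_pos b
    rw [invCapacity, ENNReal.ofReal_sum_of_nonneg fun _ _ => by positivity]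
    refine Finset.sum_congr rfl fun i _ => ?_
    rw [ENNReal.ofReal_pow (by positivity), ENNReal.ofReal_inv_of_pos this,
      ENNReal.ofReal_natCast]
  simp only [h1]
  rw [← ENNReal.ofReal_sum_of_nonneg fun _ _ => (invCapacity_pos hK _).le,
    ← ENNReal.ofReal_natCast K, ← ENNReal.ofReal_mul (Nat.cast_nonneg K)]
  refine ENNReal.ofReal_le_ofReal ?_
  have h2 : (∑ b, (S.multiplicity b : ℝ)) ≤ Fintype.card 𝒟 * (μ * K * L) := by
    rw [← Nat.cast_sum, S.sum_multiplicity, Nat.cast_sum]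
    refine (Finset.sum_le_sum fun n _ => hS.storage n).trans_eq ?_
    simp
  have h3 : invCapacity K (m + 1) - invCapacity K m ≤ 0 :=
    sub_nonpos.2 (invCapacity_anti K hm (Nat.le_succ m))
  refine le_trans ?_ (Finset.sum_le_sum fun b _ =>
    invCapacity_chord_le K hm (hS.correct.multiplicity_pos b))
  rw [Finset.sum_add_distrib, ← Finset.sum_mul, Finset.sum_sub_distrib]
  simp only [Finset.sum_const, Finset.card_univ, Fintype.card_prod, Fintype.card_fin, nsmul_eq_mul,
    Nat.cast_mul]
  nlinarith

/-! ### A full storage scheme of rate `1 / invCapacity` -/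

/-- The vectors whose coordinates add up to zero. -/
def zeroSumVectors (K : ℕ) (G : Type) [AddCommGroup G] : AddSubgroup (Fin K → G) where
  carrier := {v | ∑ i, v i = 0}
  zero_mem' := by simp
  add_mem' := by
    intro v v' (hv : ∑ i, v i = 0) (hv' : ∑ i, v' i = 0)
    change ∑ i, (v + v') i = 0
    simp [Finset.sum_add_distrib, hv, hv']
  neg_mem' := by
    intro v (hv : ∑ i, v i = 0)
    change ∑ i, (-v) i = 0
    simp [hv]

section zeroSumVectors

variable {K : ℕ} {G : Type} [AddCommGroup G]

theorem mem_zeroSumVectors {v : Fin K → G} : v ∈ zeroSumVectors K G ↔ ∑ i, v i = 0 := Iff.rfl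

theorem single_sub_single_mem_zeroSumVectors (k k' : Fin K) (x : G) :
    Pi.single k x - Pi.single k' x ∈ zeroSumVectors K G := by
  simp [mem_zeroSumVectors, Finset.sum_sub_distrib]

theorem card_mul_card_zeroSumVectors [Finite G] (hK : 0 < K) :
    Nat.card G * Nat.card (zeroSumVectors K G) = Nat.card G ^ K := by
  let k : Fin K := ⟨0, hK⟩
  have e : G × zeroSumVectors K G ≃ (Fin K → G) :=
    { toFun := fun p => p.2.1 + Pi.single k p.1
      invFun := fun u => (∑ i, u i, ⟨u - Pi.single k (∑ i, u i), by
        simp [mem_zeroSumVectors, Finset.sum_sub_distrib]⟩)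
      left_inv := by
        rintro ⟨x, v, hv⟩
        rw [mem_zeroSumVectors] at hv
        simp [Finset.sum_add_distrib, hv]
      right_inv := fun u => by simp }
  rw [← Nat.card_prod, Nat.card_congr e, Nat.card_fun, Nat.card_eq_fintype_card (α := Fin K),
    Fintype.card_fin]

end zeroSumVectors

theorem card_sub_one_mul_invCapacity {K M V : ℕ} (hM : 0 < M) (hV : M * V = M ^ K) :
    ((M - 1 : ℕ) * V : ℕ) * invCapacity K M = (M * V : ℕ) - 1 := by
  have hM' : (M : ℝ) ≠ 0 := by exact_mod_cast hM.ne'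
  have h1 : (M : ℝ) * V = M ^ K := by exact_mod_cast hV
  have h2 := mul_neg_geom_sum (M : ℝ)⁻¹ K
  calc (((M - 1 : ℕ) * V : ℕ) : ℝ) * invCapacity K M
      = M * V * ((1 - (M : ℝ)⁻¹) * ∑ i ∈ Finset.range K, ((M : ℝ)⁻¹) ^ i) := by
        rw [invCapacity, Nat.cast_mul, Nat.cast_sub hM]
        push_cast
        field_simp
    _ = _ := by
        rw [h2, Nat.cast_mul, h1, mul_sub, mul_one, ← mul_pow, mul_inv_cancel₀ hM', one_pow]

theorem PMF.map_equiv_uniformOfFintype {α : Type*} [Fintype α] [Nonempty α] (f : Equiv.Perm α) :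
    (PMF.uniformOfFintype α).map f = PMF.uniformOfFintype α := by
  classical
  ext a
  rw [PMF.map_apply, tsum_eq_single (f.symm a)]
  · simp
  · intro b hb
    rw [if_neg]
    rintro rfl
    simp at hb

namespace PIRScheme

/-- Each message has one block of bits for every zero-sum vector `b`, and the bits of a block are
numbered by the nonzero elements of `G`; this is bit `x` of block `b` of message `i`, with the
convention that bit `0` is `0`. -/
def blockBit {K L : ℕ} {G V : Type} [Zero G] [DecidableEq G] (φ : V × {x : G // x ≠ 0} ≃ Fin L)
    (w : Messages K L) (i : Fin K) (b : V) (x : G) : Bool :=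
  if hx : x = 0 then false else w i (φ (b, ⟨x, hx⟩))

/-- The databases are numbered by an abelian group `G`. The user matches the blocks at random with
the zero-sum vectors, each vector being used once, and asks database `g`, for each block `b` with
vector `v`, for the sum over `i` of bit `v i` of block `b` of message `i`, where `v` has first been
increased by `g` in the coordinate of the requested message. Nothing is downloaded for the vector
`0`, and so the number of downloaded bits is the same for all queries. -/
noncomputable def permutedBlocks {𝒟 : Type} {K L : ℕ} {G : Type} [AddCommGroup G] [DecidableEq G]
    [Fintype (zeroSumVectors K G)] (e : 𝒟 ≃ G)
    (φ : zeroSumVectors K G × {x : G // x ≠ 0} ≃ Fin L) : PIRScheme 𝒟 K L where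
  stored _ := Finset.univ
  Query _ := zeroSumVectors K G → Fin K → G
  queryLaw k := (PMF.uniformOfFintype (Equiv.Perm (zeroSumVectors K G))).map
    fun σ n b => (σ b).1 + Pi.single k (e n)
  Slot _ q := {b // q b ≠ 0}
  slotFintype _ _ := inferInstance
  answer _ q z s :=
    ∑ i, blockBit φ (fun k j => z ⟨(k, j), Finset.mem_univ _⟩) i s.1 (q s.1 i)

section permutedBlocks

variable {𝒟 : Type} {K L : ℕ} {G : Type} [AddCommGroup G] [DecidableEq G]
  [Fintype (zeroSumVectors K G)] (e : 𝒟 ≃ G) (φ : zeroSumVectors K G × {x : G // x ≠ 0} ≃ Fin L)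

theorem permutedBlocks_correct : (permutedBlocks (𝒟 := 𝒟) e φ).Correct := by
  rw [correct_iff]
  intro k q hq w w' hw
  obtain ⟨σ, -, rfl⟩ := (PMF.mem_support_map_iff _ _ _).1 hq
  funext j
  obtain ⟨⟨b, x, hx⟩, rfl⟩ := φ.surjective j
  -- The answers give, for every `n`, the bit of message `k` at position `v k + e n` plus a
  -- contribution of the other messages that does not depend on `n`.
  have key (n : 𝒟) :
      blockBit φ w k b ((σ b).1 k + e n) +
        ∑ i ∈ Finset.univ.erase k, blockBit φ w i b ((σ b).1 i) =
      blockBit φ w' k b ((σ b).1 k + e n) +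
        ∑ i ∈ Finset.univ.erase k, blockBit φ w' i b ((σ b).1 i) := by
    have h1 (u : Messages K L) :
        ∑ i, blockBit φ u i b (((σ b).1 + (Pi.single k (e n) : Fin K → G)) i) =
          blockBit φ u k b ((σ b).1 k + e n) +
            ∑ i ∈ Finset.univ.erase k, blockBit φ u i b ((σ b).1 i) := by
      rw [← Finset.add_sum_erase _ _ (Finset.mem_univ k)]
      congr 1
      · simp
      · refine Finset.sum_congr rfl fun i hi => ?_
        simp [Finset.ne_of_mem_erase hi]
    rw [← h1, ← h1]
    by_cases h0 : (σ b).1 + (Pi.single k (e n) : Fin K → G) = 0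
    · rw [h0]
      simp [blockBit]
    · exact congrFun (hw n) ⟨b, h0⟩
  have h0 := key (e.symm (-(σ b).1 k))
  have h1 := key (e.symm (x - (σ b).1 k))
  simp only [Equiv.apply_symm_apply, add_neg_cancel, add_sub_cancel] at h0 h1
  rw [show blockBit φ w k b 0 = blockBit φ w' k b 0 by simp [blockBit], add_right_inj] at h0
  rw [h0, add_left_inj] at h1
  simpa [blockBit, hx] using h1

theorem permutedBlocks_private : (permutedBlocks (𝒟 := 𝒟) e φ).Private := by
  rw [private_iff]
  intro n k k'
  -- Requests of `k` and of `k'` differ by a translation of the vectors, which a random matching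
  -- absorbs.
  let τ : Equiv.Perm (zeroSumVectors K G) :=
    Equiv.addRight ⟨_, single_sub_single_mem_zeroSumVectors k k' (e n)⟩
  simp only [permutedBlocks, PMF.map_comp]
  conv_rhs => rw [← PMF.map_equiv_uniformOfFintype (Equiv.mulLeft τ), PMF.map_comp]
  congr 1
  funext σ b
  simp [τ, add_assoc]

theorem permutedBlocks_isFS (hL : 0 < L) : (permutedBlocks (𝒟 := 𝒟) e φ).IsFS :=
  ⟨hL, fun _ => rfl, permutedBlocks_correct e φ, permutedBlocks_private e φ⟩

theorem permutedBlocks_download_le [Fintype 𝒟] (c : DownloadConvention) :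
    (permutedBlocks (𝒟 := 𝒟) e φ).download c ≤
      ((Fintype.card 𝒟 * Fintype.card (zeroSumVectors K G) - 1 : ℕ) : ℝ≥0∞) := by
  classical
  refine download_le_of_bits_le _ c _ fun k q hq => Nat.cast_le.2 (Nat.le_sub_one_of_lt ?_)
  obtain ⟨σ, -, rfl⟩ := (PMF.mem_support_map_iff _ _ _).1 hq
  rw [← smul_eq_mul, ← Finset.card_univ (α := 𝒟), ← Finset.sum_const]
  refine Finset.sum_lt_sum (fun n _ => Fintype.card_subtype_le _)
    ⟨e.symm 0, Finset.mem_univ _, Fintype.card_subtype_lt (x := σ.symm 0) ?_⟩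
  simp

end permutedBlocks

/-- The scheme in which every database sends all messages. -/
noncomputable def sendAll (𝒟 : Type) (K L : ℕ) : PIRScheme 𝒟 K L where
  stored _ := Finset.univ
  Query _ := Unit
  queryLaw _ := PMF.pure fun _ => ()
  Slot _ _ := Fin K × Fin L
  slotFintype _ _ := inferInstance
  answer _ _ z s := z ⟨s, Finset.mem_univ _⟩

theorem sendAll_isFS (𝒟 : Type) [Nonempty 𝒟] (K : ℕ) {L : ℕ} (hL : 0 < L) :
    (sendAll 𝒟 K L).IsFS := by
  refine ⟨hL, fun _ => rfl, ?_, ?_⟩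
  · rw [correct_iff]
    intro k q _ w w' hw
    funext i
    exact congrFun (hw (Classical.arbitrary 𝒟)) (k, i)
  · rw [private_iff]
    exact fun _ _ _ => rfl

theorem sendAll_download_le (𝒟 : Type) [Fintype 𝒟] (K L : ℕ) (c : DownloadConvention) :
    (sendAll 𝒟 K L).download c ≤ ((Fintype.card 𝒟 * (K * L) : ℕ) : ℝ≥0∞) := by
  refine download_le_of_bits_le _ c _ fun k q _ => Nat.cast_le.2 ?_
  change ∑ _n : 𝒟, Fintype.card (Fin K × Fin L) ≤ _
  simp

/-- Full storage schemes achieve the rate `1 / invCapacity`, under both conventions. -/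
theorem exists_isFS_download_le (𝒟 : Type) [Fintype 𝒟] [Nonempty 𝒟] {K : ℕ} (hK : 0 < K)
    (c : DownloadConvention) : ∃ (L : ℕ) (S : PIRScheme 𝒟 K L), S.IsFS ∧
      S.download c ≤ ENNReal.ofReal (L * invCapacity K (Fintype.card 𝒟)) := by
  classical
  obtain ⟨M, hM⟩ : ∃ M, Fintype.card 𝒟 = M := ⟨_, rfl⟩
  have hM0 : 0 < M := hM ▸ Fintype.card_pos
  rcases (Nat.succ_le_of_lt hM0).eq_or_lt with h1 | h1
  · refine ⟨1, sendAll 𝒟 K 1, sendAll_isFS 𝒟 K one_pos, ?_⟩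
    refine (sendAll_download_le 𝒟 K 1 c).trans_eq ?_
    rw [hM, ← h1]
    simp [invCapacity]
  · have : NeZero M := ⟨hM0.ne'⟩
    have e : 𝒟 ≃ ZMod M := Fintype.equivOfCardEq (by rw [hM, ZMod.card])
    have : Fintype (zeroSumVectors K (ZMod M)) := Fintype.ofFinite _
    have hV := card_mul_card_zeroSumVectors (G := ZMod M) hK
    simp only [Nat.card_eq_fintype_card, ZMod.card] at hV
    have hL : Fintype.card (zeroSumVectors K (ZMod M) × {x : ZMod M // x ≠ 0}) =
        (M - 1) * Fintype.card (zeroSumVectors K (ZMod M)) := by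
      rw [Fintype.card_prod, mul_comm, Fintype.card_subtype_compl, Fintype.card_subtype_eq,
        ZMod.card]
    have φ := Fintype.equivFinOfCardEq hL
    refine ⟨_, permutedBlocks e φ, permutedBlocks_isFS e φ
      (Nat.mul_pos (by lia) Fintype.card_pos), ?_⟩
    refine (permutedBlocks_download_le e φ c).trans_eq ?_
    rw [hM, card_sub_one_mul_invCapacity hM0 hV, ← Nat.cast_pred
      (Nat.mul_pos hM0 Fintype.card_pos), ENNReal.ofReal_natCast]

theorem _root_.ENNReal.natCast_div_natCast_mul {L : ℕ} (hL : 0 < L) (x : ℝ≥0∞) :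
    (L : ℝ≥0∞) / (L * x) = x⁻¹ := by
  have hL' : (L : ℝ≥0∞) ≠ 0 := by exact_mod_cast hL.ne'
  rw [div_eq_mul_inv, ENNReal.mul_inv (.inl hL') (.inl (ENNReal.natCast_ne_top _)),
    ← mul_assoc, ENNReal.mul_inv_cancel hL' (ENNReal.natCast_ne_top _), one_mul]

theorem IsFSCapacityAchieving.download_le {𝒟 : Type} [Fintype 𝒟] [Nonempty 𝒟] {K L : ℕ}
    {S : PIRScheme 𝒟 K L} {c : DownloadConvention} (hS : S.IsFSCapacityAchieving c) (hK : 0 < K) :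
    S.download c ≤ ENNReal.ofReal (L * invCapacity K (Fintype.card 𝒟)) := by
  obtain ⟨L', S', hS', hD⟩ := exists_isFS_download_le 𝒟 hK c
  have hg := invCapacity_pos hK (Fintype.card 𝒟)
  set g := invCapacity K (Fintype.card 𝒟)
  rw [ENNReal.ofReal_mul (Nat.cast_nonneg _), ENNReal.ofReal_natCast] at hD ⊢
  have h1 : (ENNReal.ofReal g)⁻¹ ≤ L / S.download c :=
    calc (ENNReal.ofReal g)⁻¹ = L' / (L' * ENNReal.ofReal g) := by
          rw [ENNReal.natCast_div_natCast_mul hS'.pos]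
      _ ≤ L' / S'.download c := ENNReal.div_le_div_left hD _
      _ ≤ L / S.download c := hS.2.2 ⟨L', S', hS', rfl⟩
  have h2 := ENNReal.mul_le_of_le_div h1
  rwa [mul_comm, ← div_eq_mul_inv, ENNReal.div_le_iff_le_mul (.inl (by simpa using hg))
    (.inl ENNReal.ofReal_ne_top)] at h2

end PIRScheme

/-! ### The composed scheme -/

namespace PIRScheme

section compose

variable {N K L F : ℕ} {ℓ : Fin F → ℕ} (split : Fin K → ((Σ f : Fin F, Fin (ℓ f)) ≃ Fin L))
  (𝒩 : Fin F → Finset (Fin N)) (S : ∀ f, PIRScheme (𝒩 f) K (ℓ f))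

/-- The queries to all databases when the queries of the `f`-th scheme are `ω f`. -/
def composeQuery (ω : ∀ f, ∀ n, (S f).Query n) (n : Fin N) : (compose split 𝒩 S).Query n :=
  fun f => ω f.1 ⟨n, f.2⟩

theorem mem_support_compose_queryLaw {k : Fin K} {q : ∀ n, (compose split 𝒩 S).Query n} :
    q ∈ ((compose split 𝒩 S).queryLaw k).support ↔
      ∃ ω : ∀ f, ∀ n, (S f).Query n, (∀ f, ω f ∈ ((S f).queryLaw k).support) ∧
        q = composeQuery split 𝒩 S ω := by
  refine (PMF.mem_support_map_iff _ _ _).trans (exists_congr fun ω => and_congr ?_ eq_comm)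
  exact mem_support_independentLaw _ _

theorem compose_correct (hS : ∀ f, (S f).Correct) : (compose split 𝒩 S).Correct := by
  rw [correct_iff]
  intro k q hq w w' hw
  obtain ⟨ω, hω, rfl⟩ := (mem_support_compose_queryLaw split 𝒩 S).1 hq
  funext j
  obtain ⟨⟨f, i⟩, rfl⟩ := (split k).surjective j
  refine congrFun ((S f).correct_iff.1 (hS f) k (ω f) (hω f) (fun k i => w k (split k ⟨f, i⟩))
    (fun k i => w' k (split k ⟨f, i⟩)) fun n => ?_) i
  funext s
  exact congrFun (hw n) ⟨⟨f, n.2⟩, s⟩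

theorem compose_private (hS : ∀ f, (S f).Private) : (compose split 𝒩 S).Private := by
  rw [private_iff]
  intro n k k'
  -- Database `n` sees one query from each of the schemes in which it takes part.
  let g (f : Fin F) (q : ∀ m, (S f).Query m) (h : n ∈ 𝒩 f) : (S f).Query ⟨n, h⟩ := q ⟨n, h⟩
  have hg (f) : ((S f).queryLaw k).map (g f) = ((S f).queryLaw k').map (g f) := by
    by_cases h : n ∈ 𝒩 f
    · have : g f = (fun x _ => x) ∘ fun q : ∀ m, (S f).Query m => q ⟨n, h⟩ := rfl
      rw [this, ← PMF.map_comp, ← PMF.map_comp, (S f).private_iff.1 (hS f) ⟨n, h⟩ k k']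
    · have : g f = Function.const _ fun h' => absurd h' h := by
        funext q h'
        exact absurd h' h
      rw [this, PMF.map_const, PMF.map_const]
  have key (k) : ((compose split 𝒩 S).queryLaw k).map (fun q => q n) =
      (independentLaw fun f => ((S f).queryLaw k).map (g f)).map
        fun x (f : {f // n ∈ 𝒩 f}) => x f.1 f.2 := by
    rw [← independentLaw_map]
    simp only [compose, PMF.map_comp]
    rfl
  rw [key, key, funext hg]

theorem card_compose_stored (n : Fin N) :
    ((compose split 𝒩 S).stored n).card = K * ∑ f with n ∈ 𝒩 f, ℓ f := by
  classical
  have h (k : Fin K) : (∑ i : Fin L, if n ∈ 𝒩 ((split k).symm i).1 then 1 else 0) =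
      ∑ f with n ∈ 𝒩 f, ℓ f := by
    rw [← (split k).sum_comp, Fintype.sum_sigma, Finset.sum_filter]
    refine Finset.sum_congr rfl fun f _ => ?_
    simp
  simp only [compose, Finset.card_filter, Fintype.sum_prod_type, h]
  simp

theorem bits_compose (ω : ∀ f, ∀ n, (S f).Query n) :
    (compose split 𝒩 S).bits (composeQuery split 𝒩 S ω) = ∑ f, (S f).bits (ω f) := by
  have h (n : Fin N) : Fintype.card ((compose split 𝒩 S).Slot n
      (composeQuery split 𝒩 S ω n)) =
      ∑ f : {f // n ∈ 𝒩 f}, Fintype.card ((S f).Slot ⟨n, f.2⟩ (ω f.1 ⟨n, f.2⟩)) :=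
    Fintype.card_sigma (α := fun f : {f // n ∈ 𝒩 f} => (S f.1).Slot ⟨n, f.2⟩ (ω f.1 ⟨n, f.2⟩))
  simp only [bits, h]
  rw [← Fintype.sum_sigma' fun (n : Fin N) (f : {f // n ∈ 𝒩 f}) =>
      Fintype.card ((S f.1).Slot ⟨n, f.2⟩ (ω f.1 ⟨n, f.2⟩)),
    ← Fintype.sum_sigma' fun f (n : 𝒩 f) => Fintype.card ((S f).Slot n (ω f n))]
  exact Fintype.sum_equiv
    { toFun := fun p => ⟨p.2.1, ⟨p.1, p.2.2⟩⟩
      invFun := fun p => ⟨p.2.1, ⟨p.1, p.2.2⟩⟩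
      left_inv := fun _ => rfl
      right_inv := fun _ => rfl } _ _ fun _ => rfl

theorem compose_download_le (c : DownloadConvention) :
    (compose split 𝒩 S).download c ≤ ∑ f, (S f).download c := by
  cases c with
  | average =>
    refine iSup_le fun k => ?_
    calc ∑' q, (compose split 𝒩 S).queryLaw k q * ((compose split 𝒩 S).bits q : ℝ≥0∞)
        = ∑' ω, independentLaw (fun f => (S f).queryLaw k) ω *
            ∑ f, ((S f).bits (ω f) : ℝ≥0∞) := by
          refine (PMF.tsum_map_mul _ _ _).trans (tsum_congr fun ω => ?_)
          rw [← Nat.cast_sum, ← bits_compose split 𝒩]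
          rfl
      _ = ∑ f, ∑' q, (S f).queryLaw k q * ((S f).bits q : ℝ≥0∞) := by
          rw [PMF.tsum_mul_finset_sum]
          refine Finset.sum_congr rfl fun f _ => ?_
          conv_rhs => rw [← independentLaw_map_eval (fun f => (S f).queryLaw k) f]
          exact (PMF.tsum_map_mul (independentLaw fun f => (S f).queryLaw k) (fun ω => ω f)
            fun q => ((S f).bits q : ℝ≥0∞)).symm
      _ ≤ _ := Finset.sum_le_sum fun f _ =>
          le_iSup (fun k => ∑' q, (S f).queryLaw k q * ((S f).bits q : ℝ≥0∞)) k
  | worstCase =>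
    refine iSup_le fun k => iSup₂_le fun q hq => ?_
    obtain ⟨ω, hω, rfl⟩ := (mem_support_compose_queryLaw split 𝒩 S).1 hq
    rw [bits_compose, Nat.cast_sum]
    exact Finset.sum_le_sum fun f _ => le_iSup_of_le k (le_iSup₂
      (f := fun q (_ : q ∈ ((S f).queryLaw k).support) => ((S f).bits q : ℝ≥0∞)) (ω f) (hω f))

end compose

end PIRScheme

theorem theorem4
    (c : DownloadConvention) (N K L F : ℕ) (hN : 0 < N) (hK : 0 < K) (hF : 0 < F)
    (μ t : ℝ) (hμ : 1 / (N : ℝ) ≤ μ) (hμ' : μ ≤ 1) (ht : t = μ * N)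
    -- the fractions, and the lengths of the sub-messages
    (α : Fin F → ℚ) (hα : ∑ f, α f = 1)
    (ℓ : Fin F → ℕ) (hℓ : ∀ f, 0 < ℓ f) (hαℓ : ∀ f, (ℓ f : ℚ) = α f * L)
    -- the division of each message into sub-messages
    (split : Fin K → ((Σ f : Fin F, Fin (ℓ f)) ≃ Fin L))
    -- the groups of databases, within the storage budget
    (𝒩 : Fin F → Finset (Fin N)) (h𝒩 : ∀ f, (𝒩 f).Nonempty)
    (hstorage : ∀ n : Fin N, ∑ f with n ∈ 𝒩 f, (α f : ℝ) ≤ μ)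
    -- a capacity-achieving full storage scheme for each group
    (S : ∀ f, PIRScheme (𝒩 f) K (ℓ f)) (hS : ∀ f, (S f).IsFSCapacityAchieving c)
    -- either of the two conditions on the placement
    (hcond :
      ((∃ m : ℕ, 0 < m ∧ t = m) ∧ ∀ f, ((𝒩 f).card : ℝ) = t) ∨
      ((¬ ∃ m : ℕ, 0 < m ∧ t = m) ∧
        (∀ f, (𝒩 f).card = ⌊t⌋₊ ∨ (𝒩 f).card = ⌈t⌉₊) ∧
        ∑ f with (𝒩 f).card = ⌊t⌋₊, (α f : ℝ) = ⌈t⌉₊ - t ∧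
        ∑ f with (𝒩 f).card = ⌈t⌉₊, (α f : ℝ) = t - ⌊t⌋₊)) :
    (PIRScheme.compose split 𝒩 S).IsSCCapacityAchieving c μ := by
  have hαℓ' (f) : (ℓ f : ℝ) = L * α f := by
    have := hαℓ f
    rw [mul_comm]
    exact_mod_cast this
  have hα' : ∑ f, (α f : ℝ) = 1 := by exact_mod_cast hα
  have hL : 0 < L := by
    refine Nat.pos_of_ne_zero fun h => (hℓ ⟨0, hF⟩).ne' ?_
    have := hαℓ ⟨0, hF⟩
    rw [h, Nat.cast_zero, mul_zero] at this
    exact_mod_cast this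
  have hSC : (PIRScheme.compose split 𝒩 S).IsSC μ := by
    refine ⟨hL, fun n => ?_, PIRScheme.compose_correct split 𝒩 S fun f => (hS f).1.correct,
      PIRScheme.compose_private split 𝒩 S fun f => (hS f).1.priv⟩
    rw [PIRScheme.card_compose_stored, Nat.cast_mul, Nat.cast_sum]
    simp only [hαℓ', ← Finset.mul_sum]
    calc (K : ℝ) * (L * ∑ f with n ∈ 𝒩 f, (α f : ℝ)) ≤ K * (L * μ) := by
          gcongr
          exact hstorage n
      _ = μ * K * L := by ring
  have ht1 : 1 ≤ t := by
    rw [ht]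
    rwa [div_le_iff₀ (by exact_mod_cast hN)] at hμ
  have hm : 0 < ⌊t⌋₊ := Nat.floor_pos.2 ht1
  -- The interpolation of `invCapacity K` at `t`, attained by the groups and forced by the converse.
  set γ := invCapacity K ⌊t⌋₊ + (t - ⌊t⌋₊) * (invCapacity K (⌊t⌋₊ + 1) - invCapacity K ⌊t⌋₊)
    with hγ
  have hgroups : ∑ f, (ℓ f : ℝ) * invCapacity K (𝒩 f).card = L * γ := by
    simp only [hαℓ', mul_assoc, ← Finset.mul_sum]
    congr 1
    rcases hcond with ⟨⟨m, -, hm⟩, hcard⟩ | ⟨hint, hcard, -, hceil⟩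
    · have hfl : ⌊t⌋₊ = m := by rw [hm, Nat.floor_natCast]
      have hcard' (f) : (𝒩 f).card = m := by exact_mod_cast (hcard f).trans hm
      simp only [hcard', ← Finset.sum_mul, hα', hγ]
      rw [hfl, hm]
      ring
    · have hne : (⌊t⌋₊ : ℝ) ≠ t := fun h => hint ⟨_, hm, h.symm⟩
      have hc : ⌈t⌉₊ = ⌊t⌋₊ + 1 := by
        refine le_antisymm (Nat.ceil_le_floor_add_one t) (Nat.succ_le_of_lt ?_)
        rw [Nat.lt_ceil]
        exact lt_of_le_of_ne (Nat.floor_le (by linarith)) hne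
      have h (f) : (α f : ℝ) * invCapacity K (𝒩 f).card = α f * invCapacity K ⌊t⌋₊ +
          (if (𝒩 f).card = ⌈t⌉₊ then (α f : ℝ) else 0) *
            (invCapacity K (⌊t⌋₊ + 1) - invCapacity K ⌊t⌋₊) := by
        split_ifs with h
        · rw [h, hc]
          ring
        · rw [(hcard f).resolve_right h]
          ring
      simp only [h, Finset.sum_add_distrib, ← Finset.sum_mul, ← Finset.sum_filter, hα', hceil]
      rw [one_mul]
  have hdown : (PIRScheme.compose split 𝒩 S).download c ≤ L * ENNReal.ofReal γ := by
    refine (PIRScheme.compose_download_le split 𝒩 S c).trans ?_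
    calc ∑ f, (S f).download c
        ≤ ∑ f, ENNReal.ofReal (ℓ f * invCapacity K (𝒩 f).card) := by
          refine Finset.sum_le_sum fun f _ => ?_
          have : Nonempty (𝒩 f) := (h𝒩 f).to_subtype
          simpa using (hS f).download_le hK
      _ = L * ENNReal.ofReal γ := by
          rw [← ENNReal.ofReal_sum_of_nonneg fun f _ =>
            mul_nonneg (Nat.cast_nonneg _) (invCapacity_pos hK _).le, hgroups,
            ENNReal.ofReal_mul (Nat.cast_nonneg _), ENNReal.ofReal_natCast]
  refine ⟨hSC, ⟨L, _, hSC, rfl⟩, ?_⟩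
  rintro _ ⟨L', S', hS', rfl⟩
  have hconv := hS'.le_download c hK hm
  rw [Fintype.card_fin, ← ht, ← hγ, ENNReal.ofReal_mul (Nat.cast_nonneg _),
    ENNReal.ofReal_natCast] at hconv
  calc S'.rate c ≤ L' / (L' * ENNReal.ofReal γ) := ENNReal.div_le_div_left hconv _
    _ = L / (L * ENNReal.ofReal γ) := by
        rw [ENNReal.natCast_div_natCast_mul hS'.pos, ENNReal.natCast_div_natCast_mul hL]
    _ ≤ _ := ENNReal.div_le_div_left hdown _
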